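/- Let $n\ge 0$ be an integer, let $u<1$ be a real number, and let $f$ be a real- or complex-valued even function on the integers, $f(-x)=f(x)$. For subsets $I,J$ of $[n]=\{1,\dots,n\}$ put $n_{\in\in}=|I\cap J|$, $n_{\notin\notin}=|[n]\setminus(I\cup J)|$, $n_{\notin\in}=|J\setminus I|$, $n_{\in\notin}=|I\setminus J|$ and $k=(n-n_{\in\in}-n_{\notin\notin})/2$. Let $\tilde\zeta_n(u)$ be the $2^n\times 2^n$ matrix, with rows and columns indexed by the subsets of $[n]$, with entries $$\tilde Z_{IJ}=\delta_{n_{\notin\in},n_{\in\notin}}\,\frac{k!}{\Gamma(2+k-u)}\,f(n_{\in\in}-n_{\notin\notin}).$$ (If $n_{\notin\in}=n_{\in\notin}$, then $k$ is an integer; otherwise the entry is $0$.) A ballot path from $(0,0)$ to $(n,n-2d)$ is a lattice path consisting of $n-d$ up-steps $(1,1)$ and $d$ down-steps $(1,-1)$ that never goes below the $x$-axis. Label its steps $1,\dots,n$. For such a path $P$ let $A_P$ be the set of labels of the first $d$ up-steps and $B_P$ the set of labels of the $d$ down-steps. For $0\le d\le s\le n-d$ put $$v_{d,s}(P)=\sum_{X\subseteq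 A_P}\ \sum_{\substack{Y\subseteq[n]\setminus(A_P\cup B_P)\\ |Y|=s-d}}(-1)^{|X|}\,e_{X\cup X'\cup Y},$$ where $e_T$ is the standard unit vector indexed by $T\subseteq[n]$, and $X'$ is obtained from $B_P$ by deleting, for every $i$ such that the $i$-th element of $A_P$ (in increasing order) lies in $X$, the $i$-th element of $B_P$. Then the vectors $v_{d,s}(P)$, with $0\le d\le s\le n-d$ and $P$ a ballot path from $(0,0)$ to $(n,n-2d)$, form a basis of the $2^n$-dimensional space, and $v_{d,s}(P)$ is an eigenvector of $\tilde\zeta_n(u)$ for $$\lambda_{d,s}=f(n-2s)\,\frac{\Gamma(2+n-d-u)\,\Gamma(1+d-u)}{\Gamma(2+n-s-u)\,\Gamma(2+s-u)\,\Gamma(1-u)}.$$ The eigenvalues of $\tilde\zeta_n(u)$ are exactly the numbers $\lambda_{d,s}$, $0\le d\le s\le n-d$, with respective multiplicities $$m_d=\frac{n-2d+1}{n+1}\binom{n+1}{d}$$ independent of $s$, and $m_d$ is the number of ballot paths from $(0,0)$ to $(n,n-2d)$. Where several of the $\lambda_{d,s}$ coincide, their multiplicities are added: the characteristic polynomial of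 $\tilde\zeta_n(u)$ is $\prod_{0\le d\le s\le n-d}(x-\lambda_{d,s})^{m_d}$, and for every scalar $\mu$ the eigenspace $\{v:\tilde\zeta_n(u)v=\mu v\}$ has dimension $\sum_{(d,s):\,\lambda_{d,s}=\mu}m_d$. -/

import Mathlib

open scoped Nat

/-- The cardinality of `I ∩ J`. -/
def nInIn {n : ℕ} (I J : Finset (Fin n)) : ℕ := (I ∩ J).card

/-- The number of elements of the ground set outside `I ∪ J`. -/
def nOutOut {n : ℕ} (I J : Finset (Fin n)) : ℕ := (Finset.univ \ (I ∪ J)).card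

/-- The number of elements not in `I` but in `J`. -/
def nOutIn {n : ℕ} (I J : Finset (Fin n)) : ℕ := (J \ I).card

/-- The number of elements in `I` but not in `J`. -/
def nInOut {n : ℕ} (I J : Finset (Fin n)) : ℕ := (I \ J).card

/-- The number `k = (n - n_{∈∈} - n_{∉∉}) / 2`. It enters the matrix below only when
`n_{∉∈} = n_{∈∉}`; then `n - n_{∈∈} - n_{∉∉} = 2 n_{∉∈}` and the division is exact. -/
def halfDiff {n : ℕ} (I J : Finset (Fin n)) : ℕ := (n - nInIn I J - nOutOut I J) / 2

/-- The `2^n × 2^n` matrix, with rows and columns indexed by the subsets of an `n`-element set,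
with entries `δ_{n_{∉∈}, n_{∈∉}} · k! / Γ(2 + k - u) · f(n_{∈∈} - n_{∉∉})`. -/
noncomputable def zetaTilde {𝕜 : Type*} [RCLike 𝕜] (n : ℕ) (u : ℝ) (f : ℤ → 𝕜) :
    Matrix (Finset (Fin n)) (Finset (Fin n)) 𝕜 :=
  Matrix.of fun I J =>
    (if nOutIn I J = nInOut I J then 1 else 0) *
      (((halfDiff I J)! / Real.Gamma (2 + (halfDiff I J : ℝ) - u) : ℝ) : 𝕜) *
      f ((nInIn I J : ℤ) - (nOutOut I J : ℤ))

/-- The number `λ_{d,s}`. -/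
noncomputable def lam {𝕜 : Type*} [RCLike 𝕜] (n : ℕ) (u : ℝ) (f : ℤ → 𝕜) (d s : ℕ) : 𝕜 :=
  f ((n : ℤ) - 2 * (s : ℤ)) *
    ((Real.Gamma (2 + n - d - u) * Real.Gamma (1 + d - u) /
      (Real.Gamma (2 + n - s - u) * Real.Gamma (2 + s - u) * Real.Gamma (1 - u)) : ℝ) : 𝕜)

/-- The pairs `(d, s)` with `0 ≤ d ≤ s ≤ n - d`. -/
def pairs (n : ℕ) : Finset (ℕ × ℕ) :=
  (Finset.range (n + 1) ×ˢ Finset.range (n + 1)).filter fun p => p.1 ≤ p.2 ∧ p.2 + p.1 ≤ n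

/-- The position of `x` in `A`: the number of elements of `A` smaller than `x`. -/
def position {n : ℕ} (A : Finset (Fin n)) (x : Fin n) : ℕ := (A.filter fun a => a < x).card

/-- The complement `X'` in `B` of a subset `X` of `A` (where `A` and `B` have equal size): all
elements of `B` except those whose position in `B` is the position in `A` of an element of `X`. -/
def complIn {n : ℕ} (A B X : Finset (Fin n)) : Finset (Fin n) :=
  B.filter fun b => ∀ x ∈ X, position A x ≠ position B b

/-- The vector `v_{d,s}(A, B) = ∑_{X, Y} (-1)^{|X|} e_{X ∪ X' ∪ Y}`, summed over `X ⊆ A` and over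
the subsets `Y` of size `s - d` of the complement of `A ∪ B`. -/
def vec (𝕜 : Type*) [RCLike 𝕜] {n : ℕ} (d s : ℕ) (A B : Finset (Fin n)) :
    Finset (Fin n) → 𝕜 :=
  ∑ X ∈ A.powerset, ∑ Y ∈ (Finset.univ \ (A ∪ B)).powersetCard (s - d),
    (-1 : 𝕜) ^ X.card • Pi.single (X ∪ complIn A B X ∪ Y) (1 : 𝕜)

/-- The height after `m` steps of the lattice path starting in `(0, 0)` whose `i`-th step is an
up-step `(1, 1)` if `P i = true` and a down-step `(1, -1)` if `P i = false`. -/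
def height {n : ℕ} (P : Fin n → Bool) (m : ℕ) : ℤ :=
  ∑ i : Fin n, if (i : ℕ) < m then (if P i = true then 1 else -1) else 0

/-- The ballot paths from `(0, 0)` to `(n, n - 2d)`: lattice paths with steps `(1, 1)` and
`(1, -1)` that never go below the horizontal axis. -/
def BallotPath (n d : ℕ) : Type :=
  {P : Fin n → Bool // (∀ m ≤ n, 0 ≤ height P m) ∧ height P n = (n : ℤ) - 2 * (d : ℤ)}

/-- `A_P`, the set of labels of the first `d` up-steps of `P`. -/
def upLabels {n d : ℕ} (P : BallotPath n d) : Finset (Fin n) :=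
  Finset.univ.filter fun i =>
    P.1 i = true ∧ position (Finset.univ.filter fun j => P.1 j = true) i < d

/-- `B_P`, the set of labels of the down-steps of `P`. -/
def downLabels {n d : ℕ} (P : BallotPath n d) : Finset (Fin n) :=
  Finset.univ.filter fun i => P.1 i = false

/-- The vector `v_{d,s}(P) = v_{d,s}(A_P, B_P)`. -/
def ballotVec (𝕜 : Type*) [RCLike 𝕜] {n d : ℕ} (s : ℕ) (P : BallotPath n d) :
    Finset (Fin n) → 𝕜 :=
  vec 𝕜 d s (upLabels P) (downLabels P)

/-! The matrix only links sets of equal size, and on the `s`-subsets its entries are `f (2s - n)`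
times `L (X ^ |J \ I|)`. Here `L` (`betaFunctional`) is the functional `p ↦ Γ(1-u)⁻¹ ∫₀¹ p(t)
(1-t)^(-u) dt`, used through its moments alone. It therefore suffices to treat the matrices `t ^ |J
\ I|` with `t` an indeterminate.

Pair the `i`-th elements `a_i`, `b_i` of `A` and `B`. The vector `v_{d,s}` is a signed sum over
choices of one element from each pair, so its pairing with any multiplicative weight factors. Row
`I` gives `∏ ([b_i ∈ I] - [a_i ∈ I])` times `(1-t)^d ∑_j C(s-d,j) C(n-d-s,j) t^j`, while the product
alone is the `I`-th coordinate of the vector. Hence `v_{d,s}` is an eigenvector for every `t`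
(`sum_pow_choiceSet_of_card`). Applying `L` turns the polynomial into Beta values, summed by
Chu–Vandermonde (`betaFunctional_eigenvalue`).

For independence, the ballot condition gives `a_i < b_i`. Testing against the weights `2 ^ |J \
B_Q|` on `s`-subsets gives zero unless `B_Q` contains exactly one element of each pair, and among
such sets `B_P` has least `colexWeight`; the pairings are thus triangular. The number of ballot
paths is `C(n,d) - C(n,d-1)`, so the vectors number `2^n` and form a basis. Spectrum and
multiplicities are read off from this eigenbasis. -/

theorem position_orderEmbOfFin {n d : ℕ} {A : Finset (Fin n)} (hA : A.card = d) (i : Fin d) :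
    position A (A.orderEmbOfFin hA i) = i := by
  have h : (A.filter fun a => a < A.orderEmbOfFin hA i) =
      (Finset.Iio i).map (A.orderEmbOfFin hA).toEmbedding := by
    ext x
    simp only [Finset.mem_filter, Finset.mem_map, Finset.mem_Iio]
    constructor
    · rintro ⟨hx, hlt⟩
      have : x ∈ Set.range (A.orderEmbOfFin hA) := by simpa using hx
      obtain ⟨j, rfl⟩ := this
      exact ⟨j, by simpa using hlt, rfl⟩
    · rintro ⟨j, hj, rfl⟩
      exact ⟨by simp, by simpa using hj⟩
  rw [position, h]
  simp

/-- The subset `{a i | i ∈ T} ∪ {b i | i ∉ T} ∪ Y`, where `a` and `b` enumerate `A` and `B`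
increasingly. -/
def choiceSet {n d : ℕ} {A B : Finset (Fin n)} (hA : A.card = d) (hB : B.card = d)
    (T : Finset (Fin d)) (Y : Finset (Fin n)) : Finset (Fin n) :=
  T.map (A.orderEmbOfFin hA).toEmbedding ∪ (Tᶜ).map (B.orderEmbOfFin hB).toEmbedding ∪ Y

theorem map_univ_orderEmbOfFin {n d : ℕ} {A : Finset (Fin n)} (hA : A.card = d) :
    Finset.univ.map (A.orderEmbOfFin hA).toEmbedding = A := by
  ext x
  simp

theorem complIn_map {n d : ℕ} {A B : Finset (Fin n)} (hA : A.card = d) (hB : B.card = d)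
    (T : Finset (Fin d)) :
    complIn A B (T.map (A.orderEmbOfFin hA).toEmbedding) =
      (Tᶜ).map (B.orderEmbOfFin hB).toEmbedding := by
  ext x
  have hx : x ∈ B ↔ x ∈ Set.range (B.orderEmbOfFin hB) := by simp
  simp only [complIn, Finset.mem_filter, Finset.mem_map, hx, Set.mem_range]
  constructor
  · rintro ⟨⟨j, rfl⟩, h⟩
    refine ⟨j, ?_, rfl⟩
    rw [Finset.mem_compl]
    intro hj
    exact h _ ⟨j, hj, rfl⟩ (by simp [position_orderEmbOfFin])
  · rintro ⟨j, hj, rfl⟩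
    refine ⟨⟨j, rfl⟩, ?_⟩
    rintro _ ⟨i, hi, rfl⟩ h
    simp only [RelEmbedding.coe_toEmbedding, position_orderEmbOfFin] at h
    rw [Finset.mem_compl] at hj
    exact hj (Fin.ext h ▸ hi)

theorem vec_eq_sum_choiceSet (𝕜 : Type*) [RCLike 𝕜] {n d : ℕ} (s : ℕ) {A B : Finset (Fin n)}
    (hA : A.card = d) (hB : B.card = d) :
    vec 𝕜 d s A B = ∑ T : Finset (Fin d), ∑ Y ∈ (Finset.univ \ (A ∪ B)).powersetCard (s - d),
      (-1 : 𝕜) ^ T.card • Pi.single (choiceSet hA hB T Y) (1 : 𝕜) := by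
  have hp : A.powerset = (Finset.univ : Finset (Finset (Fin d))).map
      ⟨fun T => T.map (A.orderEmbOfFin hA).toEmbedding, Finset.map_injective _⟩ := by
    ext X
    simp only [Finset.mem_powerset, Finset.mem_map, Finset.mem_univ, true_and,
      Function.Embedding.coeFn_mk]
    nth_rw 1 [← map_univ_orderEmbOfFin hA]
    rw [Finset.subset_map_iff]
    simp [eq_comm]
  rw [vec, hp, Finset.sum_map]
  simp [complIn_map hA hB, choiceSet]

/-- The pairing of `vec` with an arbitrary function. -/
theorem sum_mul_vec {𝕜 : Type*} [RCLike 𝕜] {n d : ℕ} (s : ℕ) {A B : Finset (Fin n)}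
    (hA : A.card = d) (hB : B.card = d) (F : Finset (Fin n) → 𝕜) :
    ∑ J, F J * vec 𝕜 d s A B J =
      ∑ T : Finset (Fin d), ∑ Y ∈ (Finset.univ \ (A ∪ B)).powersetCard (s - d),
        (-1 : 𝕜) ^ T.card * F (choiceSet hA hB T Y) := by
  rw [vec_eq_sum_choiceSet 𝕜 s hA hB]
  simp only [Finset.sum_apply, Pi.smul_apply, Finset.mul_sum]
  rw [Finset.sum_comm]
  refine Finset.sum_congr rfl fun T _ => ?_
  rw [Finset.sum_comm]
  refine Finset.sum_congr rfl fun Y _ => ?_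
  simp [Pi.single_apply, mul_comm]

/-! ### Signed choices from pairs and their generating functions -/

section choice

variable {n d : ℕ} {A B : Finset (Fin n)} (hA : A.card = d) (hB : B.card = d)

theorem prod_choiceSet {R : Type*} [CommRing R] (hAB : Disjoint A B) (g : Fin n → R)
    {T : Finset (Fin d)} {Y : Finset (Fin n)} (hY : Y ⊆ Finset.univ \ (A ∪ B)) :
    ∏ x ∈ choiceSet hA hB T Y, g x =
      (∏ i ∈ T, g (A.orderEmbOfFin hA i)) * (∏ i ∈ Tᶜ, g (B.orderEmbOfFin hB i)) *
        ∏ y ∈ Y, g y := by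
  have h1 : T.map (A.orderEmbOfFin hA).toEmbedding ⊆ A := by
    conv_rhs => rw [← map_univ_orderEmbOfFin hA]
    exact Finset.map_subset_map.2 (Finset.subset_univ _)
  have h2 : (Tᶜ).map (B.orderEmbOfFin hB).toEmbedding ⊆ B := by
    conv_rhs => rw [← map_univ_orderEmbOfFin hB]
    exact Finset.map_subset_map.2 (Finset.subset_univ _)
  have h3 : Disjoint (A ∪ B) Y :=
    Finset.disjoint_of_subset_right hY Finset.disjoint_sdiff
  rw [choiceSet, Finset.prod_union (Finset.disjoint_of_subset_left
    (Finset.union_subset_union h1 h2) h3), Finset.prod_union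
    (Finset.disjoint_of_subset_left h1 (Finset.disjoint_of_subset_right h2 hAB)),
    Finset.prod_map, Finset.prod_map]
  rfl

theorem card_choiceSet (hAB : Disjoint A B) {T : Finset (Fin d)} {Y : Finset (Fin n)}
    (hY : Y ⊆ Finset.univ \ (A ∪ B)) : (choiceSet hA hB T Y).card = d + Y.card := by
  -- With every weight equal to `X`, the product is `X` to the cardinality, which the degree
  -- recovers.
  have h := prod_choiceSet (R := Polynomial ℤ) hA hB hAB (fun _ => Polynomial.X) (T := T) hY
  simp only [Finset.prod_const, ← pow_add] at h
  have h' := congrArg Polynomial.natDegree h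
  simp only [Polynomial.natDegree_X_pow] at h'
  rw [h', Finset.card_add_card_compl, Fintype.card_fin]

/-- Expanding the product of differences, `T` records the factors from which the `A`-term is taken;
the choice of `Y` is independent of it. -/
theorem sum_prod_choiceSet {R : Type*} [CommRing R] (hAB : Disjoint A B) (g : Fin n → R)
    (m : ℕ) :
    ∑ T : Finset (Fin d), ∑ Y ∈ (Finset.univ \ (A ∪ B)).powersetCard m,
        (-1 : R) ^ T.card * ∏ x ∈ choiceSet hA hB T Y, g x =
      (∏ i, (g (B.orderEmbOfFin hB i) - g (A.orderEmbOfFin hA i))) *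
        ∑ Y ∈ (Finset.univ \ (A ∪ B)).powersetCard m, ∏ y ∈ Y, g y := by
  rw [Finset.prod_sub, Finset.powerset_univ, Finset.sum_mul]
  refine Finset.sum_congr rfl fun T _ => ?_
  rw [Finset.mul_sum]
  refine Finset.sum_congr rfl fun Y hY => ?_
  rw [prod_choiceSet hA hB hAB g (Finset.mem_powersetCard.1 hY).1, Finset.compl_eq_univ_sdiff]
  ring

theorem prod_ite_mem_eq_pow {R : Type*} [CommRing R] (t : R) (I J : Finset (Fin n)) :
    ∏ x ∈ J, (if x ∈ I then 1 else t) = t ^ (J \ I).card := by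
  rw [Finset.prod_ite]
  simp [Finset.filter_notMem_eq_sdiff]

open Polynomial in
-- Both sides are the coefficient of `X ^ m` in the product over `y ∈ S` of `1 + X` for `y ∈ I` and
-- `1 + t X` for `y ∉ I`.
theorem sum_powersetCard_pow {R : Type*} [CommRing R] (t : R) (I S : Finset (Fin n)) (m : ℕ) :
    ∑ Y ∈ S.powersetCard m, t ^ (Y \ I).card =
      ∑ p ∈ Finset.HasAntidiagonal.antidiagonal m,
        (((S ∩ I).card.choose p.1 : R) * ((S \ I).card.choose p.2 : R)) * t ^ p.2 := by
  have h1 : ∏ y ∈ S, (1 + C (if y ∈ I then 1 else t) * X) =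
      (1 + X) ^ (S ∩ I).card * ((1 + X) ^ (S \ I).card).comp (C t * X) := by
    have : ∀ y, (1 + C (if y ∈ I then 1 else t) * X : R[X]) =
        if y ∈ I then 1 + X else 1 + C t * X := by
      intro y; split_ifs <;> simp
    simp only [this]
    rw [Finset.prod_ite]
    simp [Finset.filter_notMem_eq_sdiff, Finset.filter_mem_eq_inter]
  have h2 : (∏ y ∈ S, (1 + C (if y ∈ I then 1 else t) * X)).coeff m =
      ∑ Y ∈ S.powersetCard m, t ^ (Y \ I).card := by
    rw [Finset.prod_one_add, Polynomial.finsetSum_coeff, Finset.powersetCard_eq_filter,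
      Finset.sum_filter]
    refine Finset.sum_congr rfl fun Y _ => ?_
    rw [Finset.prod_mul_distrib, Finset.prod_const, ← map_prod, prod_ite_mem_eq_pow,
      Polynomial.coeff_C_mul_X_pow]
    simp [eq_comm]
  rw [← h2, h1, Polynomial.coeff_mul]
  refine Finset.sum_congr rfl fun p _ => ?_
  rw [Polynomial.comp_C_mul_X_coeff, Polynomial.coeff_one_add_X_pow,
    Polynomial.coeff_one_add_X_pow, mul_assoc]

/-- The product of `[b i ∈ I] - [a i ∈ I]`, where `a` and `b` enumerate `A` and `B`. -/
def pairSign (I : Finset (Fin n)) : ℤ :=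
  ∏ i, ((if B.orderEmbOfFin hB i ∈ I then 1 else 0) - if A.orderEmbOfFin hA i ∈ I then 1 else 0)

/-- For the weight `1` on `I` and `t` off `I`, each pair contributes `([b ∈ I] - [a ∈ I]) (1 - t)`.
-/
theorem sum_pow_choiceSet {R : Type*} [CommRing R] (hAB : Disjoint A B) (t : R)
    (I : Finset (Fin n)) (m : ℕ) :
    ∑ T : Finset (Fin d), ∑ Y ∈ (Finset.univ \ (A ∪ B)).powersetCard m,
        (-1 : R) ^ T.card * t ^ (choiceSet hA hB T Y \ I).card =
      (pairSign hA hB I : R) * (1 - t) ^ d * ∑ p ∈ Finset.HasAntidiagonal.antidiagonal m,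
        ((((Finset.univ \ (A ∪ B)) ∩ I).card.choose p.1 : R) *
          (((Finset.univ \ (A ∪ B)) \ I).card.choose p.2 : R)) * t ^ p.2 := by
  simp only [← sum_powersetCard_pow, ← prod_ite_mem_eq_pow]
  rw [sum_prod_choiceSet hA hB hAB]
  congr 1
  have : (1 - t) ^ d = ∏ _i : Fin d, (1 - t) := by simp
  rw [this, pairSign, Int.cast_prod, ← Finset.prod_mul_distrib]
  refine Finset.prod_congr rfl fun i _ => ?_
  split_ifs <;> simp

theorem mem_iff_not_mem_of_pairSign_ne_zero {I : Finset (Fin n)} (h : pairSign hA hB I ≠ 0)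
    (i : Fin d) : B.orderEmbOfFin hB i ∈ I ↔ A.orderEmbOfFin hA i ∉ I := by
  have := Finset.prod_ne_zero_iff.1 h i (Finset.mem_univ i)
  split_ifs at this <;> simp_all

/-- Serves twice: with `w = 1` to count elements, and with `w x = n - x` to compare colex weights.
-/
theorem sum_eq_add_sum_pairs (hAB : Disjoint A B) (w : Fin n → ℕ) (I : Finset (Fin n)) :
    ∑ x ∈ I, w x = ∑ x ∈ (Finset.univ \ (A ∪ B)) ∩ I, w x +
      ∑ i, ((if A.orderEmbOfFin hA i ∈ I then w (A.orderEmbOfFin hA i) else 0) +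
        if B.orderEmbOfFin hB i ∈ I then w (B.orderEmbOfFin hB i) else 0) := by
  have hc : ∀ {C : Finset (Fin n)} (hC : C.card = d), ∑ x ∈ C ∩ I, w x =
      ∑ i, if C.orderEmbOfFin hC i ∈ I then w (C.orderEmbOfFin hC i) else 0 := by
    intro C hC
    rw [← Finset.filter_mem_eq_inter, Finset.sum_filter]
    conv_lhs => rw [← map_univ_orderEmbOfFin hC]
    rw [Finset.sum_map]
    rfl
  rw [Finset.sum_add_distrib, ← hc hA, ← hc hB, ← Finset.sum_union, ← Finset.sum_union]
  · congr 1
    ext x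
    simp only [Finset.mem_union, Finset.mem_inter, Finset.mem_sdiff, Finset.mem_univ]
    tauto
  · rw [Finset.disjoint_left]
    simp only [Finset.mem_union, Finset.mem_inter, Finset.mem_sdiff, Finset.mem_univ]
    tauto
  · exact Finset.disjoint_of_subset_left Finset.inter_subset_left
      (Finset.disjoint_of_subset_right Finset.inter_subset_left hAB)

theorem card_inter_of_pairSign_ne_zero (hAB : Disjoint A B) {I : Finset (Fin n)}
    (h : pairSign hA hB I ≠ 0) : ((Finset.univ \ (A ∪ B)) ∩ I).card + d = I.card := by
  have h1 := sum_eq_add_sum_pairs hA hB hAB (fun _ => 1) I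
  simp only [Finset.sum_const, smul_eq_mul, mul_one] at h1
  rw [h1]
  congr 1
  have : ∀ i, ((if A.orderEmbOfFin hA i ∈ I then 1 else 0) +
      if B.orderEmbOfFin hB i ∈ I then 1 else 0) = 1 := by
    intro i
    simp only [mem_iff_not_mem_of_pairSign_ne_zero hA hB h i]
    split_ifs <;> simp_all
  simp [this]

/-- When the sign is nonzero, `I` takes exactly one element of each pair, so the sizes of `I` and
its complement off `A ∪ B` are forced. The set `I` then enters only through its sign, which is the
eigenvector property for every `t`. -/
theorem sum_pow_choiceSet_of_card {R : Type*} [CommRing R] (hAB : Disjoint A B) (t : R)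
    {s : ℕ} (hds : d ≤ s) {I : Finset (Fin n)} (hI : I.card = s) :
    ∑ T : Finset (Fin d), ∑ Y ∈ (Finset.univ \ (A ∪ B)).powersetCard (s - d),
        (-1 : R) ^ T.card * t ^ (choiceSet hA hB T Y \ I).card =
      (pairSign hA hB I : R) * ∑ j ∈ Finset.range (s - d + 1),
        (((s - d).choose j : R) * ((n - d - s).choose j : R)) * ((1 - t) ^ d * t ^ j) := by
  rw [sum_pow_choiceSet hA hB hAB, mul_assoc]
  by_cases h : pairSign hA hB I = 0
  · simp [h]
  have h1 := card_inter_of_pairSign_ne_zero hA hB hAB h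
  have h2 : ((Finset.univ \ (A ∪ B)) ∩ I).card = s - d := by omega
  have h3 : ((Finset.univ \ (A ∪ B)) \ I).card = n - d - s := by
    have h4 := Finset.card_inter_add_card_sdiff (Finset.univ \ (A ∪ B)) I
    have h5 := Finset.card_sdiff_add_card_eq_card (Finset.subset_univ (A ∪ B))
    rw [Finset.card_union_of_disjoint hAB, Finset.card_univ, Fintype.card_fin] at h5
    omega
  rw [h2, h3, Finset.mul_sum, Finset.Nat.sum_antidiagonal_eq_sum_range_succ_mk,
    ← Finset.sum_range_reflect]
  congr 1
  refine Finset.sum_congr rfl fun j hj => ?_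
  have hj' : j ≤ s - d := by simpa [Nat.lt_succ_iff] using hj
  have h6 : s - d - (s - d + 1 - 1 - j) = j := by omega
  have h7 : s - d + 1 - 1 - j = s - d - j := by omega
  simp only [h6]
  rw [h7, Nat.choose_symm hj']
  ring

theorem vec_apply_of_card_ne (𝕜 : Type*) [RCLike 𝕜] (hA : A.card = d) (hB : B.card = d)
    (hAB : Disjoint A B) {s : ℕ} (hds : d ≤ s)
    {I : Finset (Fin n)} (hI : I.card ≠ s) : vec 𝕜 d s A B I = 0 := by
  rw [vec_eq_sum_choiceSet 𝕜 s hA hB]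
  simp only [Finset.sum_apply, Pi.smul_apply]
  refine Finset.sum_eq_zero fun T _ => Finset.sum_eq_zero fun Y hY => ?_
  obtain ⟨hY1, hY2⟩ := Finset.mem_powersetCard.1 hY
  rw [Pi.single_eq_of_ne, smul_zero]
  rintro rfl
  rw [card_choiceSet hA hB hAB hY1] at hI
  omega

/-- This is the case `t = 0`: only `J ⊆ I` survives, which means `J = I` as the sizes agree. -/
theorem vec_apply_of_card (𝕜 : Type*) [RCLike 𝕜] (hAB : Disjoint A B) {s : ℕ} (hds : d ≤ s)
    {I : Finset (Fin n)} (hI : I.card = s) : vec 𝕜 d s A B I = (pairSign hA hB I : 𝕜) := by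
  have h1 : vec 𝕜 d s A B I = ∑ J, (if J = I then 1 else 0) * vec 𝕜 d s A B J := by simp
  rw [h1, sum_mul_vec s hA hB]
  have h2 := sum_pow_choiceSet_of_card hA hB hAB (0 : 𝕜) hds hI
  rw [Finset.sum_range_succ'] at h2
  simp only [sub_zero, one_pow, Nat.choose_zero_right, Nat.cast_one, pow_zero, mul_one,
    pow_succ, mul_zero, Finset.sum_const_zero, zero_add] at h2
  rw [← h2]
  refine Finset.sum_congr rfl fun T _ => Finset.sum_congr rfl fun Y hY => ?_
  obtain ⟨hY1, hY2⟩ := Finset.mem_powersetCard.1 hY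
  congr 1
  have h3 := card_choiceSet hA hB hAB (T := T) hY1
  rw [zero_pow_eq]
  refine if_congr ?_ rfl rfl
  rw [Finset.card_eq_zero, Finset.sdiff_eq_empty_iff_subset]
  exact ⟨fun h => h.subset, fun h => Finset.eq_of_subset_of_card_le h (by omega)⟩

end choice

/-! ### Beta moments and the eigenvalue -/

section beta

open Polynomial

/-- Chu–Vandermonde, by induction on `p`. Pascal's rule splits off a second sum, and absorbing `j +
1` into the binomial coefficient turns it into the same sum with `q - 1` and `c + 1`, whence the
generalization over `q` and `c`. -/
theorem sum_choose_mul_choose_div_Gamma (p q : ℕ) {c : ℝ} (hc : 0 < c) (N : ℕ) (hN : q ≤ N) :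
    ∑ j ∈ Finset.range (N + 1), ((q.choose j : ℝ) * (p.choose j : ℝ)) * (j ! / Real.Gamma (c + j)) =
      Real.Gamma (c + p + q) / (Real.Gamma (c + p) * Real.Gamma (c + q)) := by
  induction p generalizing q c N with
  | zero =>
    rw [Finset.sum_range_succ']
    have := (Real.Gamma_pos_of_pos hc).ne'
    have : Real.Gamma (c + q) ≠ 0 := (Real.Gamma_pos_of_pos (by positivity)).ne'
    simp
    field_simp
  | succ p ih =>
    have h1 := ih q hc N hN
    have key : ∑ j ∈ Finset.range (N + 1),
        ((q.choose j : ℝ) * ((p + 1).choose j : ℝ)) * (j ! / Real.Gamma (c + j)) =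
        ∑ j ∈ Finset.range (N + 1),
          ((q.choose j : ℝ) * (p.choose j : ℝ)) * (j ! / Real.Gamma (c + j)) +
        ∑ j ∈ Finset.range N,
          ((q.choose (j + 1) : ℝ) * (p.choose j : ℝ)) *
            ((j + 1)! / Real.Gamma (c + (j + 1 : ℕ))) := by
      rw [Finset.sum_range_succ', Finset.sum_range_succ' _ N, add_right_comm,
        ← Finset.sum_add_distrib]
      congr 1
      · refine Finset.sum_congr rfl fun j _ => ?_
        rw [Nat.choose_succ_succ p j]
        push_cast
        ring
      · simp
    rw [key, h1]
    have hp : 0 < c + p := by positivity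
    have hG1 : Real.Gamma (c + p) ≠ 0 := (Real.Gamma_pos_of_pos hp).ne'
    have hG2 : Real.Gamma (c + q) ≠ 0 := (Real.Gamma_pos_of_pos (by positivity)).ne'
    have e1 : Real.Gamma (c + (p + 1 : ℕ)) = (c + p) * Real.Gamma (c + p) := by
      rw [← Real.Gamma_add_one hp.ne']; push_cast; ring_nf
    have e2 : Real.Gamma (c + (p + 1 : ℕ) + q) = (c + p + q) * Real.Gamma (c + p + q) := by
      rw [← Real.Gamma_add_one (by positivity)]; push_cast; ring_nf
    rw [e1, e2]
    rcases q with _ | q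
    · simp
      field_simp
    · obtain ⟨N, rfl⟩ : ∃ M, N = M + 1 := ⟨N - 1, by omega⟩
      have h2 := ih q (c := c + 1) (by positivity) N (by omega)
      have h3 : ∑ j ∈ Finset.range (N + 1),
          (((q + 1).choose (j + 1) : ℝ) * (p.choose j : ℝ)) *
            ((j + 1)! / Real.Gamma (c + (j + 1 : ℕ))) =
          (q + 1) * ∑ j ∈ Finset.range (N + 1),
            ((q.choose j : ℝ) * (p.choose j : ℝ)) * (j ! / Real.Gamma (c + 1 + j)) := by
        rw [Finset.mul_sum]
        refine Finset.sum_congr rfl fun j _ => ?_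
        have h4 : ((q + 1).choose (j + 1) : ℝ) * (j + 1) = (q + 1) * q.choose j := by
          exact_mod_cast (Nat.add_one_mul_choose_eq q j).symm
        rw [Nat.factorial_succ]
        have h5 : c + (j + 1 : ℕ) = c + 1 + j := by push_cast; ring
        rw [h5]
        push_cast
        linear_combination (p.choose j : ℝ) * (j ! / Real.Gamma (c + 1 + j)) * h4
      rw [h3, h2]
      have e3 : Real.Gamma (c + 1 + p) = (c + p) * Real.Gamma (c + p) := by
        rw [← Real.Gamma_add_one hp.ne']; ring_nf
      have e4 : c + 1 + q = c + (q + 1 : ℕ) := by push_cast; ring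
      have e5 : c + 1 + p + q = c + p + (q + 1 : ℕ) := by push_cast; ring
      rw [e3, e5, e4]
      field_simp
      push_cast
      ring

/-- The linear functional with `X ^ k ↦ k! / Γ(2 + k - u)`. -/
noncomputable def betaFunctional (u : ℝ) : ℝ[X] →ₗ[ℝ] ℝ :=
  Polynomial.lsum fun k => (k ! / Real.Gamma (2 + k - u)) • LinearMap.id

theorem betaFunctional_X_pow (u : ℝ) (k : ℕ) :
    betaFunctional u (X ^ k) = k ! / Real.Gamma (2 + k - u) := by
  simp [betaFunctional, Polynomial.lsum_apply, Polynomial.X_pow_eq_monomial,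
    Polynomial.sum_monomial_index]

/-- The value is `B(j + 1, 1 + d - u) / Γ(1 - u)`; the induction replaces the integral by the
recurrence of `Γ`. -/
theorem betaFunctional_one_sub_X_pow_mul {u : ℝ} (hu : u < 1) (d j : ℕ) :
    betaFunctional u ((1 - X) ^ d * X ^ j) =
      Real.Gamma (1 + d - u) / Real.Gamma (1 - u) * (j ! / Real.Gamma (2 + d - u + j)) := by
  induction d generalizing j with
  | zero =>
    have : Real.Gamma (1 - u) ≠ 0 := (Real.Gamma_pos_of_pos (by linarith)).ne'
    rw [pow_zero, one_mul, betaFunctional_X_pow]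
    simp only [Nat.cast_zero, add_zero, div_self this, one_mul]
    congr 2
    ring
  | succ d ih =>
    have h : ((1 - X) ^ (d + 1) * X ^ j : ℝ[X]) =
        (1 - X) ^ d * X ^ j - (1 - X) ^ d * X ^ (j + 1) := by ring
    rw [h, map_sub, ih, ih, Nat.factorial_succ]
    have hd : 0 < 1 + (d : ℝ) - u := by have : (0 : ℝ) ≤ d := by positivity
                                        linarith
    have hj : 0 < 2 + (d : ℝ) - u + j := by have : (0 : ℝ) ≤ j := by positivity
                                            linarith
    have e1 : Real.Gamma (1 + (d + 1 : ℕ) - u) = (1 + d - u) * Real.Gamma (1 + d - u) := by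
      rw [← Real.Gamma_add_one hd.ne']; push_cast; ring_nf
    have e2 : Real.Gamma (2 + d - u + (j + 1 : ℕ)) =
        (2 + d - u + j) * Real.Gamma (2 + d - u + j) := by
      rw [← Real.Gamma_add_one hj.ne']; push_cast; ring_nf
    have e3 : Real.Gamma (2 + (d + 1 : ℕ) - u + j) =
        (2 + d - u + j) * Real.Gamma (2 + d - u + j) := by
      rw [← Real.Gamma_add_one hj.ne']; push_cast; ring_nf
    rw [e1, e2, e3]
    have : Real.Gamma (1 - u) ≠ 0 := (Real.Gamma_pos_of_pos (by linarith)).ne'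
    have : Real.Gamma (2 + d - u + j) ≠ 0 := (Real.Gamma_pos_of_pos hj).ne'
    field_simp
    push_cast
    ring

theorem betaFunctional_eigenvalue {u : ℝ} (hu : u < 1) {n d s : ℕ} (hds : d ≤ s)
    (hs : s + d ≤ n) :
    ∑ j ∈ Finset.range (s - d + 1), (((s - d).choose j : ℝ) * ((n - d - s).choose j : ℝ)) *
        betaFunctional u ((1 - X) ^ d * X ^ j) =
      Real.Gamma (2 + n - d - u) * Real.Gamma (1 + d - u) /
        (Real.Gamma (2 + n - s - u) * Real.Gamma (2 + s - u) * Real.Gamma (1 - u)) := by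
  have hd : (0 : ℝ) ≤ d := by positivity
  have h := sum_choose_mul_choose_div_Gamma (n - d - s) (s - d) (c := 2 + d - u) (by linarith)
    (s - d) le_rfl
  have e1 : 2 + (d : ℝ) - u + (n - d - s : ℕ) = 2 + n - s - u := by
    rw [Nat.sub_sub, Nat.cast_sub (by omega)]; push_cast; ring
  have e2 : 2 + (d : ℝ) - u + (s - d : ℕ) = 2 + s - u := by
    rw [Nat.cast_sub hds]; ring
  have e3 : 2 + n - s - u + (s - d : ℕ) = 2 + n - d - u := by
    rw [Nat.cast_sub hds]; ring
  rw [e1, e2, e3] at h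
  simp only [betaFunctional_one_sub_X_pow_mul hu]
  have : ∀ j : ℕ, (((s - d).choose j : ℝ) * ((n - d - s).choose j : ℝ)) *
      (Real.Gamma (1 + d - u) / Real.Gamma (1 - u) * (j ! / Real.Gamma (2 + d - u + j))) =
      Real.Gamma (1 + d - u) / Real.Gamma (1 - u) *
      ((((s - d).choose j : ℝ) * ((n - d - s).choose j : ℝ)) *
       (j ! / Real.Gamma (2 + d - u + j))) := fun j => by ring
  simp only [this]
  rw [← Finset.mul_sum, h]
  simp only [div_eq_mul_inv, mul_inv]
  ring

theorem card_sdiff_eq_iff {n : ℕ} (I J : Finset (Fin n)) :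
    nOutIn I J = nInOut I J ↔ J.card = I.card := by
  have h1 := Finset.card_sdiff_add_card_inter I J
  have h2 := Finset.card_sdiff_add_card_inter J I
  rw [Finset.inter_comm] at h2
  unfold nOutIn nInOut
  omega

theorem nOutOut_add {n : ℕ} (I J : Finset (Fin n)) :
    nOutOut I J + (J \ I).card + I.card = n := by
  have h1 := Finset.card_sdiff_add_card_eq_card (Finset.subset_univ (I ∪ J))
  have h2 : (I ∪ J).card = (J \ I).card + I.card := by
    rw [Finset.union_comm, Finset.card_sdiff_add_card]
  rw [Finset.card_univ, Fintype.card_fin] at h1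
  unfold nOutOut
  omega

theorem nInIn_add {n : ℕ} (I J : Finset (Fin n)) : nInIn I J + (J \ I).card = J.card := by
  rw [nInIn, Finset.inter_comm, add_comm, Finset.card_sdiff_add_card_inter]

theorem zetaTilde_apply_of_card_ne {𝕜 : Type*} [RCLike 𝕜] {n : ℕ} (u : ℝ) (f : ℤ → 𝕜)
    {I J : Finset (Fin n)} (h : J.card ≠ I.card) : zetaTilde n u f I J = 0 := by
  simp [zetaTilde, card_sdiff_eq_iff, h]

theorem zetaTilde_apply_of_card_eq {𝕜 : Type*} [RCLike 𝕜] {n : ℕ} (u : ℝ) (f : ℤ → 𝕜)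
    {I J : Finset (Fin n)} (h : J.card = I.card) : zetaTilde n u f I J =
      f (2 * I.card - n) * ((betaFunctional u (X ^ (J \ I).card) : ℝ) : 𝕜) := by
  have h1 := nOutOut_add I J
  have h2 := nInIn_add I J
  have h3 : halfDiff I J = (J \ I).card := by unfold halfDiff; omega
  have h4 : (nInIn I J : ℤ) - nOutOut I J = 2 * I.card - n := by omega
  rw [zetaTilde, Matrix.of_apply, if_pos ((card_sdiff_eq_iff I J).2 h), h3, h4,
    betaFunctional_X_pow]
  ring

theorem zetaTilde_mulVec_vec {𝕜 : Type*} [RCLike 𝕜] {n d s : ℕ} {u : ℝ} (hu : u < 1)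
    {f : ℤ → 𝕜} (hf : ∀ x : ℤ, f (-x) = f x) {A B : Finset (Fin n)} (hA : A.card = d)
    (hB : B.card = d) (hAB : Disjoint A B) (hds : d ≤ s) (hs : s + d ≤ n) :
    (zetaTilde n u f).mulVec (vec 𝕜 d s A B) = lam n u f d s • vec 𝕜 d s A B := by
  ext I
  rw [Pi.smul_apply, smul_eq_mul, Matrix.mulVec, dotProduct]
  by_cases hI : I.card = s
  · rw [sum_mul_vec s hA hB, vec_apply_of_card hA hB 𝕜 hAB hds hI]
    -- The generating identity is taken at `t = X`, so that the functional converts powers of `t`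
    -- into matrix entries.
    have h1 := congrArg (fun p => ((betaFunctional u p : ℝ) : 𝕜))
      (sum_pow_choiceSet_of_card hA hB hAB (X : ℝ[X]) hds hI)
    have e1 : ∀ k : ℕ, (-1 : ℝ[X]) ^ k = C ((-1) ^ k) := fun k => by simp
    have e2 : (pairSign hA hB I : ℝ[X]) = C (pairSign hA hB I : ℝ) := by simp
    have e3 : ∀ a b : ℕ, (a : ℝ[X]) * (b : ℝ[X]) = C ((a : ℝ) * b) := fun a b => by simp
    beta_reduce at h1
    simp only [e1, e2, e3, ← Polynomial.smul_eq_C_mul, map_sum (betaFunctional u), map_smul,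
      smul_eq_mul] at h1
    rw [betaFunctional_eigenvalue hu hds hs] at h1
    -- Evenness of `f` reconciles the argument in the entries with the one in `lam`.
    have e4 : f (2 * I.card - n) = f (n - 2 * s) := by rw [← hf, hI]; congr 1; ring
    have h2 : ∑ T : Finset (Fin d), ∑ Y ∈ (Finset.univ \ (A ∪ B)).powersetCard (s - d),
        (-1 : 𝕜) ^ T.card * zetaTilde n u f I (choiceSet hA hB T Y) =
        f (n - 2 * s) *
        ((∑ T : Finset (Fin d), ∑ Y ∈ (Finset.univ \ (A ∪ B)).powersetCard (s - d),
        (-1 : ℝ) ^ T.card * betaFunctional u (X ^ (choiceSet hA hB T Y \ I).card) : ℝ) : 𝕜) := by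
      push_cast
      simp only [Finset.mul_sum]
      refine Finset.sum_congr rfl fun T _ => Finset.sum_congr rfl fun Y hY => ?_
      obtain ⟨hY1, hY2⟩ := Finset.mem_powersetCard.1 hY
      rw [zetaTilde_apply_of_card_eq, e4]
      · ring
      · rw [card_choiceSet hA hB hAB hY1]; omega
    rw [h2, h1, lam]
    push_cast
    ring
  · rw [vec_apply_of_card_ne 𝕜 hA hB hAB hds hI, mul_zero]
    refine Finset.sum_eq_zero fun J _ => ?_
    by_cases hJ : J.card = s
    · rw [zetaTilde_apply_of_card_ne u f (by omega), zero_mul]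
    · rw [vec_apply_of_card_ne 𝕜 hA hB hAB hds hJ, mul_zero]

end beta

/-! ### Ballot paths and their labels -/

theorem height_eq_sub {n : ℕ} (P : Fin n → Bool) (m : ℕ) :
    height P m = ((Finset.univ.filter fun i : Fin n => P i = true ∧ (i : ℕ) < m).card : ℤ) -
      (Finset.univ.filter fun i : Fin n => P i = false ∧ (i : ℕ) < m).card := by
  rw [height, Finset.card_filter, Finset.card_filter]
  push_cast
  rw [← Finset.sum_sub_distrib]
  refine Finset.sum_congr rfl fun i _ => ?_
  cases P i <;> by_cases h : (i : ℕ) < m <;> simp [h]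

theorem card_true_add_card_false {n : ℕ} (P : Fin n → Bool) :
    (Finset.univ.filter fun i : Fin n => P i = true).card +
      (Finset.univ.filter fun i : Fin n => P i = false).card = n := by
  have := Finset.card_filter_add_card_filter_not (s := (Finset.univ : Finset (Fin n)))
    (fun i => P i = true)
  simpa using this

namespace BallotPath

variable {n d : ℕ} (P : BallotPath n d)

theorem card_down : (downLabels P).card = d := by
  have h1 := P.2.2
  rw [height_eq_sub] at h1
  have h2 := card_true_add_card_false P.1
  simp only [Fin.is_lt, and_true] at h1
  unfold downLabels
  omega

theorem two_mul_le (P : BallotPath n d) : 2 * d ≤ n := by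
  have h1 := P.2.1 n le_rfl
  rw [P.2.2] at h1
  omega

theorem card_up : (upLabels P).card = d := by
  have h2 := card_true_add_card_false P.1
  have h3 := P.card_down
  have h4 := P.two_mul_le
  unfold downLabels at h3
  set U := Finset.univ.filter fun j => P.1 j = true with hU
  have hd : d ≤ U.card := by omega
  have h5 : upLabels P = (Finset.univ : Finset (Fin d)).map
      ((Fin.castLEEmb hd).trans (U.orderEmbOfFin rfl).toEmbedding) := by
    ext x
    simp only [upLabels, Finset.mem_filter, Finset.mem_univ, true_and, Finset.mem_map,
      Function.Embedding.trans_apply]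
    have hx : P.1 x = true ↔ x ∈ Set.range (U.orderEmbOfFin rfl) := by simp [hU]
    rw [hx, ← hU]
    constructor
    · rintro ⟨⟨i, rfl⟩, hi⟩
      rw [position_orderEmbOfFin] at hi
      exact ⟨⟨i, hi⟩, rfl⟩
    · rintro ⟨i, rfl⟩
      refine ⟨⟨_, rfl⟩, ?_⟩
      have := position_orderEmbOfFin (A := U) rfl (Fin.castLEEmb hd i)
      refine lt_of_eq_of_lt this ?_
      simp
  rw [h5, Finset.card_map, Finset.card_univ, Fintype.card_fin]

theorem disjoint_labels : Disjoint (upLabels P) (downLabels P) := by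
  rw [Finset.disjoint_left]
  intro x hx hx'
  simp only [upLabels, downLabels, Finset.mem_filter] at hx hx'
  simp_all

/-- Otherwise the prefix ending at the down-step `b` has `i + 1` down-steps (`i` counts from `0`)
but at most `i` up-steps, and the path is below the axis there. -/
theorem up_lt_down (i : Fin d) :
    (upLabels P).orderEmbOfFin P.card_up i < (downLabels P).orderEmbOfFin P.card_down i := by
  set a := (upLabels P).orderEmbOfFin P.card_up i with ha
  set b := (downLabels P).orderEmbOfFin P.card_down i with hb
  have haA : a ∈ upLabels P := Finset.orderEmbOfFin_mem _ _ _
  have hbB : b ∈ downLabels P := Finset.orderEmbOfFin_mem _ _ _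
  have hpa : position (upLabels P) a = i := position_orderEmbOfFin _ _
  have hpb : position (downLabels P) b = i := position_orderEmbOfFin _ _
  have hne : a ≠ b := fun h => Finset.disjoint_left.1 P.disjoint_labels haA (h ▸ hbB)
  by_contra hlt
  have hba : b < a := lt_of_le_of_ne (not_lt.1 hlt) hne.symm
  have h1 := P.2.1 (b + 1) b.2
  rw [height_eq_sub] at h1
  have h2 : (Finset.univ.filter fun j : Fin n => P.1 j = false ∧ (j : ℕ) < b + 1) =
      insert b ((downLabels P).filter fun j => j < b) := by
    ext j
    simp only [downLabels, Finset.mem_filter, Finset.mem_univ, true_and, Finset.mem_insert] at hbB ⊢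
    rw [Nat.lt_succ_iff, ← Fin.le_def, le_iff_eq_or_lt]
    constructor
    · rintro ⟨h, h'⟩
      tauto
    · rintro (rfl | h)
      · exact ⟨hbB, Or.inl rfl⟩
      · exact ⟨h.1, Or.inr h.2⟩
  have h3 : (Finset.univ.filter fun j : Fin n => P.1 j = true ∧ (j : ℕ) < b + 1).card ≤
      position (upLabels P) a := by
    refine Finset.card_le_card fun j hj => ?_
    simp only [upLabels, Finset.mem_filter, Finset.mem_univ, true_and] at hj haA ⊢
    have hja : j < a := lt_of_le_of_lt (Fin.le_def.2 (Nat.lt_succ_iff.1 hj.2)) hba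
    -- An up-step before `a` has no more predecessors than `a`, so it too is among the first `d`.
    refine ⟨⟨hj.1, lt_of_le_of_lt (Finset.card_le_card fun k hk => ?_) haA.2⟩, hja⟩
    simp only [Finset.mem_filter, Finset.mem_univ, true_and] at hk ⊢
    exact ⟨hk.1, hk.2.trans hja⟩
  rw [h2, Finset.card_insert_of_notMem (by simp)] at h1
  unfold position at hpb
  omega

theorem downLabels_injective : Function.Injective (downLabels : BallotPath n d → _) := by
  intro P Q h
  refine Subtype.ext (funext fun i => ?_)
  have := congrArg (i ∈ ·) h
  simp only [downLabels, Finset.mem_filter, Finset.mem_univ, true_and, eq_iff_iff] at this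
  cases hP : P.1 i <;> cases hQ : Q.1 i <;> simp_all

instance : Finite (BallotPath n d) := Subtype.finite

end BallotPath

/-! ### Counting ballot paths -/

theorem height_snoc_of_le {n : ℕ} (P : Fin n → Bool) (c : Bool) {m : ℕ} (hm : m ≤ n) :
    height (Fin.snoc P c : Fin (n + 1) → Bool) m = height P m := by
  simp [height, Fin.sum_univ_castSucc, hm]

theorem height_snoc_last {n : ℕ} (P : Fin n → Bool) (c : Bool) :
    height (Fin.snoc P c : Fin (n + 1) → Bool) (n + 1) =
      height P n + if c = true then 1 else -1 := by
  simp [height, Fin.sum_univ_castSucc]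

theorem ballot_snoc_iff {n : ℕ} (P : Fin n → Bool) (c : Bool) :
    (∀ m ≤ n + 1, 0 ≤ height (Fin.snoc P c : Fin (n + 1) → Bool) m) ↔
      (∀ m ≤ n, 0 ≤ height P m) ∧
        0 ≤ height (Fin.snoc P c : Fin (n + 1) → Bool) (n + 1) := by
  constructor
  · intro h
    exact ⟨fun m hm => by rw [← height_snoc_of_le P c hm]; exact h m (by omega), h _ le_rfl⟩
  · rintro ⟨h1, h2⟩ m hm
    rcases Nat.lt_or_ge n m with h | h
    · obtain rfl : m = n + 1 := by omega
      exact h2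
    · rw [height_snoc_of_le P c h]; exact h1 m h

/-- Lattice paths that stay nonnegative and end at the height `h`. -/
def NonnegPath (n : ℕ) (h : ℤ) : Type :=
  {P : Fin n → Bool // (∀ m ≤ n, 0 ≤ height P m) ∧ height P n = h}

instance (n : ℕ) (h : ℤ) : Finite (NonnegPath n h) := Subtype.finite

/-- Splitting off the last step of a path. -/
def nonnegPathSuccEquiv (n : ℕ) {h : ℤ} (hh : 0 ≤ h) :
    NonnegPath (n + 1) h ≃ NonnegPath n (h - 1) ⊕ NonnegPath n (h + 1) where
  toFun P :=
    have hP : (Fin.snoc (Fin.init P.1) (P.1 (Fin.last n)) : Fin (n + 1) → Bool) = P.1 :=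
      Fin.snoc_init_self _
    if hc : P.1 (Fin.last n) = true then
      Sum.inl ⟨Fin.init P.1, ((ballot_snoc_iff _ _).1 (hP ▸ P.2.1)).1, by
        have h1 := height_snoc_last (Fin.init P.1) (P.1 (Fin.last n))
        rw [hP, P.2.2, hc] at h1
        simp only [if_true] at h1
        omega⟩
    else
      Sum.inr ⟨Fin.init P.1, ((ballot_snoc_iff _ _).1 (hP ▸ P.2.1)).1, by
        have h1 := height_snoc_last (Fin.init P.1) (P.1 (Fin.last n))
        rw [hP, P.2.2, if_neg hc] at h1
        omega⟩
  invFun := Sum.elim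
    (fun P => ⟨Fin.snoc P.1 true, (ballot_snoc_iff _ _).2 ⟨P.2.1, by
      rw [height_snoc_last, P.2.2]; simpa using hh⟩, by
      rw [height_snoc_last, P.2.2]; simp⟩)
    (fun P => ⟨Fin.snoc P.1 false, (ballot_snoc_iff _ _).2 ⟨P.2.1, by
      rw [height_snoc_last, P.2.2]; simpa using hh⟩, by
      rw [height_snoc_last, P.2.2]; simp⟩)
  left_inv P := by
    have hP : (Fin.snoc (Fin.init P.1) (P.1 (Fin.last n)) : Fin (n + 1) → Bool) = P.1 :=
      Fin.snoc_init_self _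
    refine Subtype.ext ?_
    cases hc : P.1 (Fin.last n)
    · rw [hc] at hP
      dsimp only
      rw [dif_neg (by simp [hc])]
      exact hP
    · rw [hc] at hP
      dsimp only
      rw [dif_pos hc]
      exact hP
  right_inv P := by
    rcases P with P | P
    · refine (dif_pos (Fin.snoc_last (α := fun _ => Bool) true P.1)).trans ?_
      exact congrArg Sum.inl (Subtype.ext (Fin.init_snoc (α := fun _ => Bool) true P.1))
    · refine (dif_neg ?_).trans ?_
      · exact fun h => Bool.false_ne_true
          ((Fin.snoc_last (α := fun _ => Bool) false P.1).symm.trans h)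
      · exact congrArg Sum.inr (Subtype.ext (Fin.init_snoc (α := fun _ => Bool) false P.1))

theorem card_nonnegPath_of_neg (n : ℕ) {h : ℤ} (hh : h < 0) : Nat.card (NonnegPath n h) = 0 := by
  have : IsEmpty (NonnegPath n h) := ⟨fun P => by
    have h1 := P.2.1 n le_rfl
    rw [P.2.2] at h1
    omega⟩
  simp

theorem card_nonnegPath_of_lt (n : ℕ) {h : ℤ} (hh : n < h) : Nat.card (NonnegPath n h) = 0 := by
  have : IsEmpty (NonnegPath n h) := ⟨fun P => by
    have h1 := P.2.2
    rw [height_eq_sub] at h1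
    have h2 := card_true_add_card_false P.1
    simp only [Fin.is_lt, and_true] at h1
    omega⟩
  simp

theorem card_nonnegPath_succ (n : ℕ) {h : ℤ} (hh : 0 ≤ h) :
    Nat.card (NonnegPath (n + 1) h) =
      Nat.card (NonnegPath n (h - 1)) + Nat.card (NonnegPath n (h + 1)) := by
  rw [Nat.card_congr (nonnegPathSuccEquiv n hh), Nat.card_sum]

theorem card_nonnegPath_zero_zero : Nat.card (NonnegPath 0 0) = 1 := by
  rw [Nat.card_eq_one_iff_unique]
  refine ⟨⟨fun P Q => Subtype.ext (Subsingleton.elim _ _)⟩, ⟨⟨fun _ => true, ?_⟩⟩⟩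
  simp [height]

/-- The reflection principle. -/
theorem card_nonnegPath_add (n d : ℕ) (hd : 2 * d ≤ n + 1) :
    Nat.card (NonnegPath n (n - 2 * d)) + (if d = 0 then 0 else n.choose (d - 1)) =
      n.choose d := by
  induction n generalizing d with
  | zero =>
    obtain rfl : d = 0 := by omega
    simpa using card_nonnegPath_zero_zero
  | succ n ih =>
    -- The final height `-1` is admitted because removing an up-step from a path ending at `0` leads
    -- there; no path qualifies, and the two binomials agree by symmetry.
    by_cases h0 : 2 * d = n + 2
    · obtain ⟨d, rfl⟩ : ∃ e, d = e + 1 := ⟨d - 1, by omega⟩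
      rw [card_nonnegPath_of_neg _ (by push_cast; omega), zero_add, if_neg (by omega)]
      exact Nat.choose_symm_of_eq_add (by omega)
    rw [card_nonnegPath_succ n (by push_cast; omega)]
    have h1 := ih d (by omega)
    have e1 : (((n + 1 : ℕ) : ℤ) - 2 * d - 1) = n - 2 * d := by push_cast; ring
    rw [e1]
    rcases d with _ | d
    · rw [card_nonnegPath_of_lt n (h := ((n + 1 : ℕ) : ℤ) - 2 * (0 : ℕ) + 1) (by push_cast; omega)]
      simpa using h1
    · have h2 := ih d (by omega)
      have e2 : (((n + 1 : ℕ) : ℤ) - 2 * (d + 1 : ℕ) + 1) = n - 2 * d := by push_cast; ring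
      rw [e2, Nat.choose_succ_succ n d]
      rw [if_neg (by omega), Nat.add_sub_cancel] at h1 ⊢
      rcases d with _ | d
      · simp at h1 h2 ⊢
        omega
      · rw [if_neg (by omega), Nat.add_sub_cancel] at h2
        have h3 := Nat.choose_succ_succ n d
        simp only [Nat.succ_eq_add_one] at *
        omega

theorem card_ballotPath_add (n d : ℕ) (hd : 2 * d ≤ n) :
    Nat.card (BallotPath n d) + (if d = 0 then 0 else n.choose (d - 1)) = n.choose d :=
  card_nonnegPath_add n d (by omega)

theorem card_ballotPath (n d : ℕ) (hd : 2 * d ≤ n) :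
    (Nat.card (BallotPath n d) : ℚ) =
      ((n : ℚ) - 2 * d + 1) / (n + 1) * ((n + 1).choose d : ℚ) := by
  have h := card_ballotPath_add n d hd
  have hn : (n : ℚ) + 1 ≠ 0 := by positivity
  rcases d with _ | d
  · simp at h ⊢
    rw [h, div_self hn]
    simp
  · rw [if_neg (by omega), Nat.add_sub_cancel] at h
    have h1 : ((n + 1).choose (d + 1) : ℚ) * (d + 1) = (n + 1) * n.choose d := by
      exact_mod_cast (Nat.add_one_mul_choose_eq n d).symm
    have h2 : ((n + 1).choose (d + 1) : ℚ) = n.choose d + n.choose (d + 1) := by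
      exact_mod_cast Nat.choose_succ_succ n d
    have h3 : (Nat.card (BallotPath n (d + 1)) : ℚ) + n.choose d = n.choose (d + 1) := by
      exact_mod_cast h
    field_simp
    push_cast
    linear_combination (n + 1) * h3 - (n + 1) * h2 + 2 * h1

theorem sum_card_ballotPath (n k : ℕ) (hk : 2 * k ≤ n) :
    ∑ d ∈ Finset.range (k + 1), Nat.card (BallotPath n d) = n.choose k := by
  induction k with
  | zero => simpa using card_ballotPath_add n 0 (by omega)
  | succ k ih =>
    rw [Finset.sum_range_succ, ih (by omega), ← card_ballotPath_add n (k + 1) hk]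
    simp [add_comm]

/-- For fixed `s` the admissible `d` are those up to `min s (n - s)`, so the sum over `d` telescopes
to `n.choose s`. -/
theorem sum_pairs_card_ballotPath (n : ℕ) :
    ∑ p ∈ pairs n, Nat.card (BallotPath n p.1) = 2 ^ n := by
  rw [pairs, Finset.sum_filter, Finset.sum_product_right, ← Nat.sum_range_choose]
  refine Finset.sum_congr rfl fun s hs => ?_
  have hs' : s ≤ n := by simpa [Nat.lt_succ_iff] using hs
  have h : n.choose s = n.choose (min s (n - s)) := by
    rcases le_total s (n - s) with h | h
    · rw [min_eq_left h]
    · rw [min_eq_right h, Nat.choose_symm hs']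
  rw [h, ← sum_card_ballotPath n _ (by omega), ← Finset.sum_filter]
  refine Finset.sum_congr ?_ fun _ _ => rfl
  ext d
  simp only [Finset.mem_filter, Finset.mem_range]
  omega

/-! ### Linear algebra: triangular families and eigenbases -/

theorem linearIndependent_of_triangular {ι K V : Type*} [Field K] [AddCommGroup V] [Module K V]
    {v : ι → V} (l : ι → V →ₗ[K] K) (key : ι → ℕ) (hdiag : ∀ i, l i (v i) ≠ 0)
    (hoff : ∀ i j, i ≠ j → l i (v j) ≠ 0 → key j < key i) : LinearIndependent K v := by
  classical
  rw [linearIndependent_iff']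
  intro s g hg
  by_contra! h
  obtain ⟨i, hi, hgi⟩ := h
  -- At a term of least key with nonzero coefficient, `l j` annihilates every other term of the
  -- relation.
  obtain ⟨j, hj, hmin⟩ := Finset.exists_min_image (s.filter fun i => g i ≠ 0) key
    ⟨i, Finset.mem_filter.2 ⟨hi, hgi⟩⟩
  obtain ⟨hjs, hgj⟩ := Finset.mem_filter.1 hj
  have h0 := congrArg (l j) hg
  simp only [map_sum, map_smul, smul_eq_mul, map_zero] at h0
  rw [Finset.sum_eq_single_of_mem j hjs] at h0
  · exact (mul_ne_zero hgj (hdiag j)) h0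
  · intro k hk hkj
    by_contra hne
    obtain ⟨h1, h2⟩ := mul_ne_zero_iff.1 hne
    have := hoff j k hkj.symm h2
    exact absurd (hmin k (Finset.mem_filter.2 ⟨hk, h1⟩)) (not_le.2 this)

section eigenbasis

variable {ι K V : Type*} [Field K] [AddCommGroup V] [Module K V] {T : V →ₗ[K] V}
  {b : Module.Basis ι K V} {ev : ι → K}

theorem repr_apply_of_eigenbasis (hb : ∀ i, T (b i) = ev i • b i) (v : V) (i : ι) :
    b.repr (T v) i = ev i * b.repr v i := by
  have : b.coord i ∘ₗ T = ev i • b.coord i := by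
    refine b.ext fun j => ?_
    simp only [LinearMap.comp_apply, hb, map_smul, LinearMap.smul_apply, smul_eq_mul,
      Module.Basis.coord_apply, Module.Basis.repr_self]
    by_cases h : j = i
    · rw [h]
    · rw [Finsupp.single_eq_of_ne (Ne.symm h), mul_zero, mul_zero]
  exact LinearMap.congr_fun this v

theorem eigenspace_eq_span_of_eigenbasis (hb : ∀ i, T (b i) = ev i • b i) (μ : K) :
    Module.End.eigenspace T μ = Submodule.span K (b '' {i | ev i = μ}) := by
  ext v
  rw [Module.End.mem_eigenspace_iff, Module.Basis.mem_span_image]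
  constructor
  · intro h i hi
    have h1 := repr_apply_of_eigenbasis hb v i
    rw [h, map_smul, Finsupp.smul_apply, smul_eq_mul] at h1
    exact (mul_right_cancel₀ (Finsupp.mem_support_iff.1 hi) h1).symm
  · intro h
    refine b.repr.injective (Finsupp.ext fun i => ?_)
    rw [repr_apply_of_eigenbasis hb, map_smul, Finsupp.smul_apply, smul_eq_mul]
    by_cases hi : i ∈ (b.repr v).support
    · rw [show ev i = μ from h hi]
    · rw [Finsupp.notMem_support_iff.1 hi, mul_zero, mul_zero]

theorem finrank_eigenspace_of_eigenbasis [Fintype ι] [DecidableEq K]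
    (hb : ∀ i, T (b i) = ev i • b i) (μ : K) :
    Module.finrank K (Module.End.eigenspace T μ) =
      (Finset.univ.filter fun i => ev i = μ).card := by
  have h := b.linearIndependent.comp (Subtype.val : {i // ev i = μ} → ι) Subtype.val_injective
  rw [eigenspace_eq_span_of_eigenbasis hb, Set.image_eq_range]
  refine (finrank_span_eq_card h).trans ?_
  exact Fintype.card_subtype _

theorem charpoly_of_eigenbasis [Fintype ι] [Module.Finite K V]
    (hb : ∀ i, T (b i) = ev i • b i) :
    T.charpoly = ∏ i, (Polynomial.X - Polynomial.C (ev i)) := by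
  classical
  have h : LinearMap.toMatrix b b T = Matrix.diagonal ev := by
    ext i j
    rw [LinearMap.toMatrix_apply, hb, map_smul, Module.Basis.repr_self, Finsupp.smul_apply,
      Finsupp.single_apply, Matrix.diagonal_apply, smul_eq_mul]
    by_cases hij : i = j
    · subst hij; simp
    · simp [hij, Ne.symm hij]
  rw [← LinearMap.charpoly_toMatrix T b, h, Matrix.charpoly_diagonal]

theorem hasEigenvalue_iff_of_eigenbasis [Fintype ι] (hb : ∀ i, T (b i) = ev i • b i) (μ : K) :
    Module.End.HasEigenvalue T μ ↔ ∃ i, ev i = μ := by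
  classical
  have : Module.Finite K V := Module.Finite.of_basis b
  rw [Module.End.hasEigenvalue_iff, ne_eq, ← Submodule.finrank_eq_zero,
    finrank_eigenspace_of_eigenbasis hb, Finset.card_eq_zero, Finset.filter_eq_empty_iff]
  simp

end eigenbasis

/-! ### Independence of the ballot vectors -/

/-- A weight on subsets that decreases when an element is replaced by a larger one. -/
def colexWeight {n : ℕ} (S : Finset (Fin n)) : ℕ := ∑ x ∈ S, (n - x)

/-- `S` has one element of each pair: taking some `a_i` in place of the larger `b_i` raises the
weight, and otherwise `S` contains `B`, any extra element having weight at least `1`. -/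
theorem eq_or_colexWeight_lt {n d : ℕ} {A B : Finset (Fin n)} (hA : A.card = d) (hB : B.card = d)
    (hAB : Disjoint A B) (hlt : ∀ i, A.orderEmbOfFin hA i < B.orderEmbOfFin hB i)
    {S : Finset (Fin n)} (h : pairSign hA hB S ≠ 0) : S = B ∨ colexWeight B < colexWeight S := by
  have hmem := mem_iff_not_mem_of_pairSign_ne_zero hA hB h
  by_cases hS : ∃ i, A.orderEmbOfFin hA i ∈ S
  · right
    obtain ⟨i, hi⟩ := hS
    rw [colexWeight, colexWeight, sum_eq_add_sum_pairs hA hB hAB _ S]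
    refine lt_of_lt_of_le ?_ (Nat.le_add_left _ _)
    conv_lhs => rw [← map_univ_orderEmbOfFin hB]
    rw [Finset.sum_map]
    have hle : ∀ j, n - (B.orderEmbOfFin hB j : ℕ) ≤ n - (A.orderEmbOfFin hA j : ℕ) := fun j => by
      have := Fin.lt_def.1 (hlt j)
      omega
    refine Finset.sum_lt_sum (fun j _ => ?_) ⟨i, Finset.mem_univ i, ?_⟩
    · simp only [hmem j, RelEmbedding.coe_toEmbedding]
      have := hle j
      split_ifs <;> simp_all
    · have := Fin.lt_def.1 (hlt i)
      have := (A.orderEmbOfFin hA i).2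
      simp only [hmem i, hi, RelEmbedding.coe_toEmbedding, if_true, not_true, if_false]
      omega
  · push Not at hS
    have hBS : B ⊆ S := by
      conv_lhs => rw [← map_univ_orderEmbOfFin hB]
      intro x hx
      obtain ⟨i, -, rfl⟩ := Finset.mem_map.1 hx
      exact (hmem i).2 (hS i)
    by_cases hne : S = B
    · exact Or.inl hne
    · right
      obtain ⟨x, hxS, hxB⟩ := Finset.exists_of_ssubset (hBS.ssubset_of_ne (Ne.symm hne))
      exact Finset.sum_lt_sum_of_subset hBS hxS hxB (by have := x.2; omega) fun _ _ _ => Nat.zero_le _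

/-- The functional `v ↦ ∑_{|J| = s} 2 ^ |J \ S| v_J`. -/
noncomputable def twoPowFunctional (𝕜 : Type*) [RCLike 𝕜] {n : ℕ} (s : ℕ) (S : Finset (Fin n)) :
    (Finset (Fin n) → 𝕜) →ₗ[𝕜] 𝕜 :=
  ∑ J, (if J.card = s then (2 : 𝕜) ^ (J \ S).card else 0) • LinearMap.proj J

section pairing

variable {𝕜 : Type*} [RCLike 𝕜] {n d s : ℕ} {A B : Finset (Fin n)}

theorem twoPowFunctional_vec_of_ne (hA : A.card = d) (hB : B.card = d) (hAB : Disjoint A B)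
    (hds : d ≤ s) {s' : ℕ} (hs : s' ≠ s) (S : Finset (Fin n)) :
    twoPowFunctional 𝕜 s' S (vec 𝕜 d s A B) = 0 := by
  simp only [twoPowFunctional, LinearMap.sum_apply, LinearMap.smul_apply, LinearMap.proj_apply,
    smul_eq_mul]
  refine Finset.sum_eq_zero fun J _ => ?_
  by_cases hJ : J.card = s
  · rw [if_neg (by omega), zero_mul]
  · rw [vec_apply_of_card_ne 𝕜 hA hB hAB hds hJ, mul_zero]

theorem twoPowFunctional_vec (hA : A.card = d) (hB : B.card = d) (hAB : Disjoint A B)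
    (hds : d ≤ s) (S : Finset (Fin n)) :
    twoPowFunctional 𝕜 s S (vec 𝕜 d s A B) =
      (pairSign hA hB S : 𝕜) * (1 - 2) ^ d *
        ∑ p ∈ Finset.HasAntidiagonal.antidiagonal (s - d),
        ((((Finset.univ \ (A ∪ B)) ∩ S).card.choose p.1 : 𝕜) *
          (((Finset.univ \ (A ∪ B)) \ S).card.choose p.2 : 𝕜)) * 2 ^ p.2 := by
  rw [← sum_pow_choiceSet hA hB hAB]
  simp only [twoPowFunctional, LinearMap.sum_apply, LinearMap.smul_apply, LinearMap.proj_apply,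
    smul_eq_mul]
  rw [sum_mul_vec s hA hB]
  refine Finset.sum_congr rfl fun T _ => Finset.sum_congr rfl fun Y hY => ?_
  obtain ⟨hY1, hY2⟩ := Finset.mem_powersetCard.1 hY
  rw [if_pos]
  rw [card_choiceSet hA hB hAB hY1]
  omega

/-- The value `2` keeps `(1 - t)^d` nonzero and the remaining sum a positive integer. Testing at
`B`, of size `d` rather than `s`, rules out `t = 0` when `d < s`. -/
theorem twoPowFunctional_vec_self_ne_zero (hA : A.card = d) (hB : B.card = d)
    (hAB : Disjoint A B) (hds : d ≤ s) (hs : s + d ≤ n) :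
    twoPowFunctional 𝕜 s B (vec 𝕜 d s A B) ≠ 0 := by
  rw [twoPowFunctional_vec hA hB hAB hds]
  have h1 : pairSign hA hB B = 1 := by
    refine Finset.prod_eq_one fun i _ => ?_
    rw [if_pos (Finset.orderEmbOfFin_mem _ _ _), if_neg, sub_zero]
    exact Finset.disjoint_left.1 hAB (Finset.orderEmbOfFin_mem _ _ _)
  have h2 : (Finset.univ \ (A ∪ B)) \ B = Finset.univ \ (A ∪ B) := by
    rw [sdiff_sdiff_left, Finset.sup_eq_union, Finset.union_assoc, Finset.union_self]
  have h3 : (Finset.univ \ (A ∪ B)).card = n - 2 * d := by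
    rw [Finset.card_univ_sdiff, Fintype.card_fin, Finset.card_union_of_disjoint hAB]
    omega
  rw [h1, h2, h3]
  refine mul_ne_zero (mul_ne_zero (by simp) (pow_ne_zero _ (by norm_num))) ?_
  have h4 : ∑ p ∈ Finset.HasAntidiagonal.antidiagonal (s - d),
      (((Finset.univ \ (A ∪ B)) ∩ B).card.choose p.1 * (n - 2 * d).choose p.2) * 2 ^ p.2 ≠ 0 := by
    refine (Finset.sum_pos' (fun _ _ => Nat.zero_le _) ⟨(0, s - d), by simp, ?_⟩).ne'
    have : 0 < (n - 2 * d).choose (s - d) := Nat.choose_pos (by omega)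
    simp only [Nat.choose_zero_right]
    positivity
  exact_mod_cast (Nat.cast_ne_zero (R := 𝕜)).2 h4

end pairing

theorem mem_pairs {n : ℕ} {p : ℕ × ℕ} : p ∈ pairs n ↔ p.1 ≤ p.2 ∧ p.2 + p.1 ≤ n := by
  simp only [pairs, Finset.mem_filter, Finset.mem_product, Finset.mem_range]
  omega

theorem linearIndependent_ballotVec (𝕜 : Type*) [RCLike 𝕜] (n : ℕ) :
    LinearIndependent 𝕜 fun i : (p : {p // p ∈ pairs n}) × BallotPath n p.1.1 =>
      ballotVec 𝕜 i.1.1.2 i.2 := by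
  refine linearIndependent_of_triangular
    (fun i => twoPowFunctional 𝕜 i.1.1.2 (downLabels i.2))
    (fun i => colexWeight (downLabels i.2)) ?_ ?_
  · rintro ⟨⟨⟨d, s⟩, hp⟩, P⟩
    obtain ⟨h1, h2⟩ := mem_pairs.1 hp
    exact twoPowFunctional_vec_self_ne_zero P.card_up P.card_down P.disjoint_labels h1 h2
  · rintro ⟨⟨⟨d, s⟩, hp⟩, P⟩ ⟨⟨⟨d', s'⟩, hp'⟩, P'⟩ hne h
    obtain ⟨h1, h2⟩ := mem_pairs.1 hp'
    dsimp only [ballotVec] at h h1 h2 P P' ⊢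
    by_cases hs : s = s'
    · subst hs
      rw [twoPowFunctional_vec P'.card_up P'.card_down P'.disjoint_labels h1] at h
      have h3 : pairSign P'.card_up P'.card_down (downLabels P) ≠ 0 := by
        rintro h0
        simp [h0] at h
      rcases eq_or_colexWeight_lt P'.card_up P'.card_down P'.disjoint_labels P'.up_lt_down h3
        with h4 | h4
      · refine absurd ?_ hne
        -- The set of down-steps determines `d` as well as the path, so different `d` need no
        -- separate argument.
        obtain rfl : d = d' := by rw [← P.card_down, ← P'.card_down, h4]
        obtain rfl := BallotPath.downLabels_injective h4
        rfl
      · exact h4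
    · exact absurd (twoPowFunctional_vec_of_ne P'.card_up P'.card_down P'.disjoint_labels h1
        hs _) h

/-! ### Dimension count and the spectrum -/

theorem card_sigma_ballotPath (n : ℕ) :
    Nat.card ((p : {p // p ∈ pairs n}) × BallotPath n p.1.1) = 2 ^ n := by
  rw [Nat.card_sigma, ← sum_pairs_card_ballotPath,
    Finset.sum_coe_sort (pairs n) fun p => Nat.card (BallotPath n p.1)]

theorem prod_sigma_ballotPath {M : Type*} [CommMonoid M] (n : ℕ)
    [Fintype ((p : {p // p ∈ pairs n}) × BallotPath n p.1.1)] (g : ℕ × ℕ → M) :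
    ∏ i : (p : {p // p ∈ pairs n}) × BallotPath n p.1.1, g i.1.1 =
      ∏ p ∈ pairs n, g p ^ Nat.card (BallotPath n p.1) := by
  have (d : ℕ) : Fintype (BallotPath n d) := Fintype.ofFinite _
  rw [← Finset.prod_coe_sort (pairs n)]
  have h : ∏ i : (p : {p // p ∈ pairs n}) × BallotPath n p.1.1, g i.1.1 =
      ∏ p : {p // p ∈ pairs n}, ∏ _P : BallotPath n p.1.1, g p.1 := by
    rw [← Fintype.prod_sigma (fun i : (p : {p // p ∈ pairs n}) × BallotPath n p.1.1 => g i.1.1)]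
    exact Finset.prod_congr (by ext; simp) fun _ _ => rfl
  rw [h]
  refine Finset.prod_congr rfl fun p _ => ?_
  rw [Finset.prod_const, Finset.card_univ, Nat.card_eq_fintype_card]

theorem ballotPath_card_pos {n d : ℕ} (hd : 2 * d ≤ n) : 0 < Nat.card (BallotPath n d) := by
  have h := card_ballotPath n d hd
  have h1 : (0 : ℚ) < (n + 1).choose d := by exact_mod_cast Nat.choose_pos (by omega)
  have h2 : (2 * d : ℚ) ≤ n := by exact_mod_cast hd
  have h3 : (0 : ℚ) < (n : ℚ) - 2 * d + 1 := by linarith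
  have : (0 : ℚ) < Nat.card (BallotPath n d) := by rw [h]; positivity
  exact_mod_cast this

theorem theorem6 {𝕜 : Type*} [RCLike 𝕜] [DecidableEq 𝕜] (n : ℕ) (u : ℝ) (hu : u < 1)
    (f : ℤ → 𝕜) (hf : ∀ x : ℤ, f (-x) = f x) :
    -- the vectors `v_{d,s}(P)` form a basis of eigenvectors, with eigenvalues `λ_{d,s}`
    (∃ b : Module.Basis ((p : {p // p ∈ pairs n}) × BallotPath n p.1.1) 𝕜 (Finset (Fin n) → 𝕜),
      ∀ i, b i = ballotVec 𝕜 i.1.1.2 i.2 ∧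
        (zetaTilde n u f).mulVec (b i) = lam n u f i.1.1.1 i.1.1.2 • b i) ∧
    -- the eigenvalues are exactly the `λ_{d,s}`
    (∀ μ : 𝕜, Module.End.HasEigenvalue (Matrix.toLin' (zetaTilde n u f)) μ ↔
      ∃ p ∈ pairs n, μ = lam n u f p.1 p.2) ∧
    -- the multiplicities, which add up where several of the `λ_{d,s}` coincide
    ∃ m : ℕ → ℕ,
      (∀ d : ℕ, 2 * d ≤ n →
        (m d : ℚ) = ((n : ℚ) - 2 * d + 1) / (n + 1) * ((n + 1).choose d : ℚ)) ∧
      (∀ d : ℕ, 2 * d ≤ n → Nat.card (BallotPath n d) = m d) ∧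
      (zetaTilde n u f).charpoly =
        ∏ p ∈ pairs n, (Polynomial.X - Polynomial.C (lam n u f p.1 p.2)) ^ m p.1 ∧
      ∀ μ : 𝕜, Module.finrank 𝕜 (Module.End.eigenspace (Matrix.toLin' (zetaTilde n u f)) μ) =
        ∑ p ∈ pairs n with lam n u f p.1 p.2 = μ, m p.1 := by
  have : Fintype ((p : {p // p ∈ pairs n}) × BallotPath n p.1.1) := Fintype.ofFinite _
  have hcard : Fintype.card ((p : {p // p ∈ pairs n}) × BallotPath n p.1.1) =
      Module.finrank 𝕜 (Finset (Fin n) → 𝕜) := by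
    rw [← Nat.card_eq_fintype_card, card_sigma_ballotPath]
    simp
  let b := basisOfLinearIndependentOfCardEqFinrank' _ (linearIndependent_ballotVec 𝕜 n) hcard
  have hb : ∀ i, b i = ballotVec 𝕜 i.1.1.2 i.2 := fun i => by
    simp only [b, coe_basisOfLinearIndependentOfCardEqFinrank']
  have hev : ∀ i, (zetaTilde n u f).mulVec (b i) = lam n u f i.1.1.1 i.1.1.2 • b i := by
    rintro ⟨⟨⟨d, s⟩, hp⟩, P⟩
    obtain ⟨h1, h2⟩ := mem_pairs.1 hp
    rw [hb]
    exact zetaTilde_mulVec_vec hu hf P.card_up P.card_down P.disjoint_labels h1 h2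
  have hT : ∀ i, Matrix.toLin' (zetaTilde n u f) (b i) = lam n u f i.1.1.1 i.1.1.2 • b i := by
    simpa only [Matrix.toLin'_apply] using hev
  refine ⟨⟨b, fun i => ⟨hb i, hev i⟩⟩, fun μ => ?_, fun d => Nat.card (BallotPath n d),
    fun d hd => card_ballotPath n d hd, fun _ _ => rfl, ?_, fun μ => ?_⟩
  · rw [hasEigenvalue_iff_of_eigenbasis hT]
    constructor
    · rintro ⟨i, hi⟩
      exact ⟨i.1.1, i.1.2, hi.symm⟩
    · rintro ⟨p, hp, rfl⟩
      obtain ⟨h1, h2⟩ := mem_pairs.1 hp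
      obtain ⟨P⟩ := (Nat.card_pos_iff.1 (ballotPath_card_pos (n := n) (d := p.1) (by omega))).1
      exact ⟨⟨⟨p, hp⟩, P⟩, rfl⟩
  · rw [← Matrix.charpoly_toLin', charpoly_of_eigenbasis hT]
    exact prod_sigma_ballotPath n fun p => Polynomial.X - Polynomial.C (lam n u f p.1 p.2)
  · rw [finrank_eigenspace_of_eigenbasis hT, Finset.card_filter, Finset.sum_filter]
    -- The product formula read in `Multiplicative ℕ` counts the basis vectors with eigenvalue `μ`.
    have h := prod_sigma_ballotPath n fun p =>
      Multiplicative.ofAdd (if lam n u f p.1 p.2 = μ then 1 else 0 : ℕ)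
    simp only [← ofAdd_sum, ← ofAdd_nsmul] at h
    simpa using Multiplicative.ofAdd.injective h
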